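/- For $(x,\theta)$ in $T\mathbb S^{1}=\{(x,\theta)\in\mathbb R^2\times\mathbb S^1 : x\cdot\theta=0\}$, a weight $W:\mathbb R^2\times\mathbb S^1\to\mathbb R$ and a function $f:\mathbb R^2\to\mathbb R$, let $$P_Wf(x,\theta)=\int_{\mathbb R}W(x+t\theta,\theta)\,f(x+t\theta)\,dt$$ be the weighted ray transform. For $\alpha\in(0,1)$ and $u:\mathbb R^2\times\mathbb S^1\to\mathbb R$ let $$\|u\|_{C^\alpha}=\sup_{y}|u(y)|+\sup_{0<|y_1-y_2|\le 1}\frac{|u(y_1)-u(y_2)|}{|y_1-y_2|^{\alpha}},$$ where $|y_1-y_2|$ is the Euclidean distance of $\mathbb R^2\times\mathbb R^2\supset\mathbb R^2\times\mathbb S^1$, and let $C^\alpha(\mathbb R^2\times\mathbb S^1)$ be the space of all $u$ with $\|u\|_{C^\alpha}<\infty$. For every $\alpha\in(0,1/16)$ there is $N>0$ such that for every $\delta>0$ there are a weight $W_\delta:\mathbb R^2\times\mathbb S^1\to\mathbb R$ and a function $f_\delta:\mathbb R^2\to\mathbb R$ satisfying $$W_\delta\ge \tfrac12 \text{ on } \mathbb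 R^2\times\mathbb S^1,\qquad W_\delta\in C^\alpha(\mathbb R^2\times\mathbb S^1),\qquad \|W_\delta\|_{C^\alpha(\mathbb R^2\times\mathbb S^1)}\le N,$$ $$f_\delta\in C^\infty(\mathbb R^2),\qquad f_\delta\not\equiv0,\qquad \operatorname{supp}f_\delta\subseteq\overline B(0,\delta)=\{x\in\mathbb R^2:|x|\le\delta\},$$ $$P_{W_\delta}f_\delta\equiv0\quad\text{on }T\mathbb S^1.$$ -/

import Mathlib

open scoped ContDiff

noncomputable section

namespace WeightedRay

/-- The phase space `ℝ^d × S^{d-1}`, with the Euclidean distance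
`|(x₁,θ₁) - (x₂,θ₂)|² = |x₁ - x₂|² + |θ₁ - θ₂|²` of `ℝ^d × ℝ^d`. -/
abbrev PhaseSpace (d : ℕ) : Type :=
  WithLp 2 (EuclideanSpace ℝ (Fin d) × Metric.sphere (0 : EuclideanSpace ℝ (Fin d)) 1)

/-- The point `(x, θ)` of `ℝ^d × S^{d-1}`. -/
def PhaseSpace.mk {d : ℕ} (x : EuclideanSpace ℝ (Fin d))
    (θ : Metric.sphere (0 : EuclideanSpace ℝ (Fin d)) 1) : PhaseSpace d :=
  WithLp.toLp 2 (x, θ)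

/-- `T S^{d-1} = {(x, θ) : x · θ = 0}`, the set of all oriented straight lines of `ℝ^d`. -/
def tangentSphere (d : ℕ) : Set (PhaseSpace d) :=
  {p | inner ℝ p.fst (p.snd : EuclideanSpace ℝ (Fin d)) = 0}

/-- The weighted ray transform `P_W f (x, θ) = ∫_ℝ W(x + tθ, θ) f(x + tθ) dt`. -/
def rayTransform {d : ℕ} (W : PhaseSpace d → ℝ) (f : EuclideanSpace ℝ (Fin d) → ℝ)
    (p : PhaseSpace d) : ℝ :=
  ∫ t : ℝ, W (PhaseSpace.mk (p.fst + t • (p.snd : EuclideanSpace ℝ (Fin d))) p.snd) *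
    f (p.fst + t • (p.snd : EuclideanSpace ℝ (Fin d)))

/-- The supremum norm of `u`, with value `∞` if `u` is unbounded. -/
def supNorm {Y : Type*} (u : Y → ℝ) : ENNReal :=
  ⨆ y : Y, ‖u y‖ₑ

/-- The Hölder seminorm: the supremum of `|u(y₁) - u(y₂)| / |y₁ - y₂|^α`
over `0 < |y₁ - y₂| ≤ 1`. -/
def holderSeminorm {Y : Type*} [MetricSpace Y] (α : ℝ) (u : Y → ℝ) : ENNReal :=
  ⨆ (y₁ : Y) (y₂ : Y) (_ : y₁ ≠ y₂) (_ : dist y₁ y₂ ≤ 1),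
    ENNReal.ofReal (|u y₁ - u y₂| / dist y₁ y₂ ^ α)

/-- The norm of the Hölder space `C^α(Y)`, with value `∞` outside the space. -/
def holderNorm {Y : Type*} [MetricSpace Y] (α : ℝ) (u : Y → ℝ) : ENNReal :=
  supNorm u + holderSeminorm α u

/-- `u ∈ C^α(Y)` (for `α > 0` such a `u` is bounded and continuous). -/
def MemHolderSpace {Y : Type*} [MetricSpace Y] (α : ℝ) (u : Y → ℝ) : Prop :=
  holderNorm α u < ⊤

end WeightedRay

end

/-! ### Oscillatory Gaussian integrals -/

namespace WeightedRay

open MeasureTheory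

/-! After rescaling to the unit ball, put `u = 1 - |x|²`, `y = 1/u`, and take the radial function `f
= y^{3/2} exp(-y) cos(l y²)`, extended by zero. On the line at distance `√(1 - A)` from the origin,
`u = A - t²`. The substitution `y = b + s²` with `b = 1/A` has a Jacobian proportional to
`y^{-3/2}`, so for the constant weight the line integral is, up to a factor depending on `A`, the
integral `gaussOsc 1 l b` of `exp(-s²) cos(l (b + s²)²)`.

This integral is not zero but it is small: the phase is stationary only at `s = 0`, with curvature
of order `l b`, whence `abs_gaussOsc_le`. It is cancelled by subtracting from the weight a multiple
of the oscillation of `f` itself, `oscRatio l b * exp(b - y) * cos(l y²)`. Against `f` this produces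
`cos²`, whose integral stays above `1/2`, so the multiplier is `O((l b)^{-1/2})`. The line is
recovered from `(x, θ)` through `A = u + (x·θ)²`, so the correction is a function on phase space.

The correction has size `κ^{1/2}` with `κ = u/l`, and Lipschitz constant at most of order `κ^{-3}`.
Interpolation gives a `C^α` seminorm `O(l^{-1/4})` for small `α`. Shrinking the ball to radius `δ ≤
1` costs at most a factor `1/δ`, which a large `l` absorbs; hence `N` is independent of `δ`. -/

lemma integrable_lorentz {ε : ℝ} (hε : 0 < ε) :
    Integrable (fun s : ℝ => ε / (ε + s ^ 2)) ∧ ∫ s : ℝ, ε / (ε + s ^ 2) = Real.pi * √ε := by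
  have h0 : 0 < √ε := Real.sqrt_pos.2 hε
  have h1 : (fun s : ℝ => ε / (ε + s ^ 2)) = fun s : ℝ => (1 + (s / √ε) ^ 2)⁻¹ := by
    funext s
    have : (√ε) ^ 2 = ε := Real.sq_sqrt hε.le
    rw [div_pow, this]
    field_simp
  rw [h1]
  refine ⟨(integrable_inv_one_add_sq).comp_div h0.ne', ?_⟩
  rw [Measure.integral_comp_div (fun x : ℝ => (1 + x ^ 2)⁻¹) (√ε), integral_univ_inv_one_add_sq,
    abs_of_pos h0, smul_eq_mul, mul_comm]

/-- Integration by parts for the phase `φ = l (b + s²)²`, with `φ' = 4 l s (b + s²)`. Dividing by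
`φ'` is singular at the stationary point `s = 0`, so `1/s` is replaced by `s / (ε + s²)`. -/
lemma hasDerivAt_oscillating_primitive {c l b ε : ℝ} (hl : 0 < l) (hb : 0 < b) (hε : 0 < ε)
    (s : ℝ) :
    HasDerivAt (fun s : ℝ => Real.exp (-c * s ^ 2) * (s / (ε + s ^ 2)) *
        (Real.sin (l * (b + s ^ 2) ^ 2) / (4 * l * (b + s ^ 2))))
      (Real.exp (-c * s ^ 2) * Real.cos (l * (b + s ^ 2) ^ 2) * (s ^ 2 / (ε + s ^ 2)) +
        Real.exp (-c * s ^ 2) * Real.sin (l * (b + s ^ 2) ^ 2) *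
          (-(2 * c * s ^ 2) / (ε + s ^ 2) + (ε - s ^ 2) / (ε + s ^ 2) ^ 2
            - 2 * s ^ 2 / ((ε + s ^ 2) * (b + s ^ 2))) / (4 * l * (b + s ^ 2))) s := by
  have hes : ε + s ^ 2 ≠ 0 := by positivity
  have hbs : b + s ^ 2 ≠ 0 := by positivity
  have d2 : HasDerivAt (fun s : ℝ => s ^ 2) (2 * s) s := by simpa using hasDerivAt_pow 2 s
  have dE := (d2.const_mul (-c)).exp
  have dq := (hasDerivAt_id s).div (d2.const_add ε) hes
  have dS : HasDerivAt (fun s : ℝ => Real.sin (l * (b + s ^ 2) ^ 2))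
      (Real.cos (l * (b + s ^ 2) ^ 2) * (l * (2 * (b + s ^ 2) * (2 * s)))) s := by
    simpa using (((d2.const_add b).fun_pow 2).const_mul l).sin
  have dR := dS.div ((d2.const_add b).const_mul (4 * l)) (by positivity)
  convert! (dE.mul dq).mul dR using 1
  simp only [id_eq, Pi.mul_apply, Pi.div_apply]
  field_simp
  ring

/-- A Gaussian integral with the oscillating factor `cos (l (b + s²)²)`. -/
noncomputable def gaussOsc (c l b : ℝ) : ℝ :=
  ∫ s : ℝ, Real.exp (-c * s ^ 2) * Real.cos (l * (b + s ^ 2) ^ 2)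

lemma integrable_gaussOsc {c : ℝ} (hc : 0 < c) (l b : ℝ) :
    Integrable (fun s : ℝ => Real.exp (-c * s ^ 2) * Real.cos (l * (b + s ^ 2) ^ 2)) := by
  refine (integrable_exp_neg_mul_sq hc).mono' (by fun_prop) (.of_forall fun s => ?_)
  rw [Real.norm_eq_abs, abs_mul, abs_of_pos (Real.exp_pos _)]
  exact mul_le_of_le_one_right (Real.exp_pos _).le (Real.abs_cos_le_one _)

/-- Stationary phase. The integrand differs from an exact derivative by a multiple of `ε / (ε +
s²)`, whose integral is `π √ε`. The choice `ε = 1 / (l b)`, the squared width of the stationary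
region, balances the cut-off error with the integration by parts. -/
lemma abs_gaussOsc_le {c l b : ℝ} (hc : 0 < c) (hl : 0 < l) (hb : 0 < b) :
    |gaussOsc c l b| ≤ 8 / √(l * b) := by
  set ε : ℝ := 1 / (l * b) with hεd
  have hlb : 0 < l * b := by positivity
  have hε : 0 < ε := by positivity
  obtain ⟨hLi, hLe⟩ := integrable_lorentz hε
  set A : ℝ → ℝ := fun s => Real.exp (-c * s ^ 2) * (s / (ε + s ^ 2)) *
        (Real.sin (l * (b + s ^ 2) ^ 2) / (4 * l * (b + s ^ 2))) with hA
  set A' : ℝ → ℝ := fun s =>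
      Real.exp (-c * s ^ 2) * Real.cos (l * (b + s ^ 2) ^ 2) * (s ^ 2 / (ε + s ^ 2)) +
        Real.exp (-c * s ^ 2) * Real.sin (l * (b + s ^ 2) ^ 2) *
          (-(2 * c * s ^ 2) / (ε + s ^ 2) + (ε - s ^ 2) / (ε + s ^ 2) ^ 2
            - 2 * s ^ 2 / ((ε + s ^ 2) * (b + s ^ 2))) / (4 * l * (b + s ^ 2)) with hA'
  have hder : ∀ s, HasDerivAt A (A' s) s := fun s =>
    hasDerivAt_oscillating_primitive hl hb hε s
  have hes : ∀ s : ℝ, 0 < ε + s ^ 2 := fun s => by positivity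
  have hbs : ∀ s : ℝ, 0 < b + s ^ 2 := fun s => by positivity
  have hA'c : Continuous A' := by
    have h1 : ∀ s : ℝ, ε + s ^ 2 ≠ 0 := fun s => (hes s).ne'
    have h2 : ∀ s : ℝ, b + s ^ 2 ≠ 0 := fun s => (hbs s).ne'
    simp only [hA']
    fun_prop (disch := intros; first | apply h1 | (have := h1; have := h2; simp_all [hl.ne']))
  -- Here `9/4 = 1 + 5/4`: the cut-off error contributes 1, the sine terms `(2 + 1 + 2) / 4`.
  have hdiff : ∀ s : ℝ, |Real.exp (-c * s ^ 2) * Real.cos (l * (b + s ^ 2) ^ 2) - A' s|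
      ≤ 9 / 4 * (ε / (ε + s ^ 2)) := by
    intro s
    have hE : 0 < Real.exp (-c * s ^ 2) := Real.exp_pos _
    have hE1 : Real.exp (-c * s ^ 2) ≤ 1 := Real.exp_le_one_iff.2 (by nlinarith [sq_nonneg s])
    have hEs : Real.exp (-c * s ^ 2) * (c * s ^ 2) ≤ 1 := by
      have h1 : c * s ^ 2 ≤ Real.exp (c * s ^ 2) := by
        linarith [Real.add_one_le_exp (c * s ^ 2)]
      have h2 : Real.exp (-c * s ^ 2) * Real.exp (c * s ^ 2) = 1 := by
        rw [← Real.exp_add]; simp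
      calc _ ≤ Real.exp (-c * s ^ 2) * Real.exp (c * s ^ 2) := by gcongr
        _ = 1 := h2
    set E := Real.exp (-c * s ^ 2)
    set C := Real.cos (l * (b + s ^ 2) ^ 2)
    set S := Real.sin (l * (b + s ^ 2) ^ 2)
    have hC : |C| ≤ 1 := Real.abs_cos_le_one _
    have hS : |S| ≤ 1 := Real.abs_sin_le_one _
    have e1 : E * C - A' s = E * C * (ε / (ε + s ^ 2)) -
        S * (E * (-(2 * c * s ^ 2) / (ε + s ^ 2) + (ε - s ^ 2) / (ε + s ^ 2) ^ 2
            - 2 * s ^ 2 / ((ε + s ^ 2) * (b + s ^ 2))) / (4 * l * (b + s ^ 2))) := by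
      have h1 := (hes s).ne'
      have h2 := (hbs s).ne'
      have : E * C = E * C * (ε / (ε + s ^ 2)) + E * C * (s ^ 2 / (ε + s ^ 2)) := by
        field_simp
      have : A' s = E * C * (s ^ 2 / (ε + s ^ 2)) +
        E * S * (-(2 * c * s ^ 2) / (ε + s ^ 2) + (ε - s ^ 2) / (ε + s ^ 2) ^ 2
            - 2 * s ^ 2 / ((ε + s ^ 2) * (b + s ^ 2))) / (4 * l * (b + s ^ 2)) := rfl
      linear_combination ‹E * C = _› - this
    have b1 : |E * (-(2 * c * s ^ 2) / (ε + s ^ 2) + (ε - s ^ 2) / (ε + s ^ 2) ^ 2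
            - 2 * s ^ 2 / ((ε + s ^ 2) * (b + s ^ 2)))| ≤ 5 / (ε + s ^ 2) := by
      have e2 : E * (-(2 * c * s ^ 2) / (ε + s ^ 2) + (ε - s ^ 2) / (ε + s ^ 2) ^ 2
            - 2 * s ^ 2 / ((ε + s ^ 2) * (b + s ^ 2))) =
          (-(2 * (E * (c * s ^ 2))) + E * ((ε - s ^ 2) / (ε + s ^ 2))
            - E * (2 * (s ^ 2 / (b + s ^ 2)))) / (ε + s ^ 2) := by
        have h1 := (hes s).ne'
        have h2 := (hbs s).ne'
        field_simp
      rw [e2, abs_div, abs_of_pos (hes s)]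
      gcongr
      have k1 : |(ε - s ^ 2) / (ε + s ^ 2)| ≤ 1 := by
        rw [abs_div, abs_of_pos (hes s), div_le_one (hes s), abs_le]
        constructor <;> nlinarith [sq_nonneg s]
      have k2 : s ^ 2 / (b + s ^ 2) ≤ 1 := by
        rw [div_le_one (hbs s)]; linarith
      have k3 : 0 ≤ s ^ 2 / (b + s ^ 2) := div_nonneg (sq_nonneg s) (hbs s).le
      have k4 : |E * ((ε - s ^ 2) / (ε + s ^ 2))| ≤ 1 := by
        rw [abs_mul, abs_of_pos hE]
        exact mul_le_one₀ hE1 (abs_nonneg _) k1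
      have k5 : 0 ≤ E * (c * s ^ 2) := by positivity
      have k6 : E * (2 * (s ^ 2 / (b + s ^ 2))) ≤ 2 := by nlinarith
      have k7 : 0 ≤ E * (2 * (s ^ 2 / (b + s ^ 2))) := by positivity
      rw [abs_le] at k4 ⊢
      constructor <;> linarith [k4.1, k4.2]
    have b2 : |S * (E * (-(2 * c * s ^ 2) / (ε + s ^ 2) + (ε - s ^ 2) / (ε + s ^ 2) ^ 2
            - 2 * s ^ 2 / ((ε + s ^ 2) * (b + s ^ 2))) / (4 * l * (b + s ^ 2)))|
        ≤ 5 / 4 * (ε / (ε + s ^ 2)) := by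
      rw [abs_mul, abs_div]
      refine (mul_le_of_le_one_left (by positivity) hS).trans ?_
      have hd : |4 * l * (b + s ^ 2)| = 4 * l * (b + s ^ 2) :=
        abs_of_pos (mul_pos (by positivity) (hbs s))
      rw [hd]
      calc _ ≤ (5 / (ε + s ^ 2)) / (4 * l * b) := by
            have := hes s
            gcongr
            nlinarith [sq_nonneg s]
        _ = _ := by
            rw [hεd]
            have := hes s
            field_simp
    have b3 : |E * C * (ε / (ε + s ^ 2))| ≤ ε / (ε + s ^ 2) := by
      have := hes s
      rw [abs_mul, abs_of_pos (div_pos hε (hes s)), abs_mul, abs_of_pos hE]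
      exact mul_le_of_le_one_left (by positivity) (mul_le_one₀ hE1 (abs_nonneg _) hC)
    rw [e1]
    refine (abs_sub _ _).trans ?_
    linarith
  have hdi : Integrable (fun s : ℝ =>
      Real.exp (-c * s ^ 2) * Real.cos (l * (b + s ^ 2) ^ 2) - A' s) := by
    refine (hLi.const_mul (9 / 4)).mono' ?_ (.of_forall hdiff)
    exact ((by fun_prop : Continuous fun s : ℝ =>
      Real.exp (-c * s ^ 2) * Real.cos (l * (b + s ^ 2) ^ 2)).sub hA'c).aestronglyMeasurable
  have hosc := integrable_gaussOsc hc l b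
  have hA'i : Integrable A' := by
    convert hosc.sub hdi using 1
    funext s
    simp
  have hAi : Integrable A := by
    have hAc : Continuous A := continuous_iff_continuousAt.2 fun s => (hder s).continuousAt
    refine ((integrable_exp_neg_mul_sq hc).mul_const (1 / √ε * (1 / (4 * l * b)))).mono'
      hAc.aestronglyMeasurable (.of_forall fun s => ?_)
    have hE : 0 < Real.exp (-c * s ^ 2) := Real.exp_pos _
    have hsq : 0 < √ε := Real.sqrt_pos.2 hε
    have q1 : |s / (ε + s ^ 2)| ≤ 1 / √ε := by
      rw [abs_div, abs_of_pos (hes s), div_le_div_iff₀ (hes s) hsq]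
      have : (√ε) ^ 2 = ε := Real.sq_sqrt hε.le
      have h3 := sq_abs s
      nlinarith [sq_nonneg (|s| - √ε), sq_nonneg (|s| + √ε), abs_nonneg s]
    have q2 : |Real.sin (l * (b + s ^ 2) ^ 2) / (4 * l * (b + s ^ 2))| ≤ 1 / (4 * l * b) := by
      rw [abs_div, abs_of_pos (mul_pos (by positivity) (hbs s) : 0 < 4 * l * (b + s ^ 2))]
      gcongr
      · exact Real.abs_sin_le_one _
      · nlinarith [sq_nonneg s]
    rw [Real.norm_eq_abs, abs_mul, abs_mul, abs_of_pos hE, mul_assoc]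
    gcongr
  have hz : ∫ s, A' s = 0 := integral_eq_zero_of_hasDerivAt_of_integrable hder hA'i hAi
  have hval : gaussOsc c l b =
      ∫ s : ℝ, (Real.exp (-c * s ^ 2) * Real.cos (l * (b + s ^ 2) ^ 2) - A' s) := by
    rw [integral_sub hosc hA'i, hz, sub_zero, gaussOsc]
  rw [hval]
  have hb1 := norm_integral_le_of_norm_le (hLi.const_mul (9 / 4))
    (Filter.Eventually.of_forall fun s => (Real.norm_eq_abs _).trans_le (hdiff s))
  rw [Real.norm_eq_abs, integral_const_mul, hLe] at hb1
  refine hb1.trans ?_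
  rw [hεd, Real.sqrt_div zero_le_one, Real.sqrt_one]
  have : 0 < √(l * b) := Real.sqrt_pos.2 hlb
  rw [mul_one_div, ← mul_div_assoc]
  gcongr
  nlinarith [Real.pi_lt_d2]

lemma abs_cos_sub_cos_le (x y : ℝ) : |Real.cos x - Real.cos y| ≤ |x - y| := by
  have := Real.lipschitzWith_cos.dist_le_mul x y
  simpa [Real.dist_eq] using this

lemma abs_gaussOsc_sub_le {c l b₁ b₂ B : ℝ} (hc : 1 ≤ c) (hl : 0 ≤ l) (h1 : 0 ≤ b₁)
    (h2 : 0 ≤ b₂) (h1B : b₁ ≤ B) (h2B : b₂ ≤ B) (hB : 1 ≤ B) :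
    |gaussOsc c l b₁ - gaussOsc c l b₂| ≤ 18 * l * B * |b₁ - b₂| := by
  have hc0 : 0 < c := by linarith
  rw [gaussOsc, gaussOsc, ← integral_sub (integrable_gaussOsc hc0 l b₁)
    (integrable_gaussOsc hc0 l b₂)]
  have hi : Integrable (fun s : ℝ => (6 * l * B * |b₁ - b₂|) * Real.exp (-(1 / 2) * s ^ 2)) :=
    (integrable_exp_neg_mul_sq (by norm_num)).const_mul _
  have hpt : ∀ s : ℝ, ‖Real.exp (-c * s ^ 2) * Real.cos (l * (b₁ + s ^ 2) ^ 2) -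
      Real.exp (-c * s ^ 2) * Real.cos (l * (b₂ + s ^ 2) ^ 2)‖ ≤
      (6 * l * B * |b₁ - b₂|) * Real.exp (-(1 / 2) * s ^ 2) := by
    intro s
    rw [← mul_sub, Real.norm_eq_abs, abs_mul, abs_of_pos (Real.exp_pos _)]
    have k1 := abs_cos_sub_cos_le (l * (b₁ + s ^ 2) ^ 2) (l * (b₂ + s ^ 2) ^ 2)
    have k2 : |l * (b₁ + s ^ 2) ^ 2 - l * (b₂ + s ^ 2) ^ 2| ≤
        l * (2 * B + 2 * s ^ 2) * |b₁ - b₂| := by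
      have : l * (b₁ + s ^ 2) ^ 2 - l * (b₂ + s ^ 2) ^ 2 =
        l * (b₁ + b₂ + 2 * s ^ 2) * (b₁ - b₂) := by ring
      rw [this, abs_mul, abs_of_nonneg (by positivity)]
      gcongr
      linarith
    -- One half of the Gaussian absorbs the growth of the phase derivative, the other half stays
    -- integrable.
    have k3 : Real.exp (-c * s ^ 2) ≤ Real.exp (-(1 / 2) * s ^ 2) * Real.exp (-(1 / 2) * s ^ 2) := by
      rw [← Real.exp_add]
      apply Real.exp_le_exp.2
      nlinarith [sq_nonneg s]
    have k4 : Real.exp (-(1 / 2) * s ^ 2) * (2 * B + 2 * s ^ 2) ≤ 6 * B := by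
      have j1 : 1 / 2 * s ^ 2 ≤ Real.exp (1 / 2 * s ^ 2) := by
        linarith [Real.add_one_le_exp (1 / 2 * s ^ 2)]
      have j2 : Real.exp (-(1 / 2) * s ^ 2) * Real.exp (1 / 2 * s ^ 2) = 1 := by
        rw [← Real.exp_add]; simp
      have j3 : Real.exp (-(1 / 2) * s ^ 2) ≤ 1 :=
        Real.exp_le_one_iff.2 (by nlinarith [sq_nonneg s])
      have j4 := Real.exp_pos (-(1 / 2) * s ^ 2)
      nlinarith [mul_le_mul_of_nonneg_left j1 j4.le]
    calc _ ≤ (Real.exp (-(1 / 2) * s ^ 2) * Real.exp (-(1 / 2) * s ^ 2)) *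
          (l * (2 * B + 2 * s ^ 2) * |b₁ - b₂|) := by
          gcongr
          exact k1.trans k2
      _ = (Real.exp (-(1 / 2) * s ^ 2) * (2 * B + 2 * s ^ 2)) *
          (l * |b₁ - b₂| * Real.exp (-(1 / 2) * s ^ 2)) := by ring
      _ ≤ (6 * B) * (l * |b₁ - b₂| * Real.exp (-(1 / 2) * s ^ 2)) := by gcongr
      _ = _ := by ring
  have := norm_integral_le_of_norm_le hi (.of_forall hpt)
  rw [Real.norm_eq_abs, integral_const_mul, integral_gaussian] at this
  refine this.trans ?_
  have h3 : √(Real.pi / (1 / 2)) ≤ 3 := by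
    rw [Real.sqrt_le_left (by norm_num)]
    nlinarith [Real.pi_lt_d2]
  have hB0 : 0 ≤ B := by linarith
  calc _ ≤ 6 * l * B * |b₁ - b₂| * 3 := by gcongr
    _ = _ := by ring

/-- The Gaussian integral with the factor `cos² (l (b + s²)²)`. -/
noncomputable def gaussOscSq (l b : ℝ) : ℝ :=
  ∫ s : ℝ, Real.exp (-2 * s ^ 2) * Real.cos (l * (b + s ^ 2) ^ 2) ^ 2

lemma gaussOscSq_eq (l b : ℝ) :
    gaussOscSq l b = (√(Real.pi / 2) + gaussOsc 2 (2 * l) b) / 2 := by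
  have h : ∀ s : ℝ, Real.exp (-2 * s ^ 2) * Real.cos (l * (b + s ^ 2) ^ 2) ^ 2 =
      (Real.exp (-2 * s ^ 2) + Real.exp (-2 * s ^ 2) * Real.cos (2 * l * (b + s ^ 2) ^ 2)) / 2 := by
    intro s
    rw [Real.cos_sq, mul_assoc 2 l]
    ring
  rw [gaussOscSq]
  simp_rw [h]
  rw [integral_div, integral_add (integrable_exp_neg_mul_sq (by norm_num))
    (integrable_gaussOsc (by norm_num) _ _), integral_gaussian, gaussOsc]

/-- The mean of `cos²` contributes `√(π/2) / 2 > 0.6`; the remainder oscillates with frequency `2 l`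
and is at most `0.1`. -/
lemma half_le_gaussOscSq {l b : ℝ} (hl : 1000 ≤ l) (hb : 1 ≤ b) : 1 / 2 ≤ gaussOscSq l b := by
  rw [gaussOscSq_eq]
  have h1 := abs_gaussOsc_le (c := 2) (l := 2 * l) (b := b) (by norm_num) (by linarith)
    (by linarith)
  have h2 : 40 ≤ √(2 * l * b) := by
    apply Real.le_sqrt_of_sq_le
    nlinarith
  have h3 : 8 / √(2 * l * b) ≤ 8 / 40 := by gcongr
  have h4 : 1.22 ≤ √(Real.pi / 2) := by
    apply Real.le_sqrt_of_sq_le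
    nlinarith [Real.pi_gt_d2]
  have := (abs_le.1 h1).1
  linarith

lemma abs_gaussOscSq_sub_le {l b₁ b₂ B : ℝ} (hl : 0 ≤ l) (h1 : 0 ≤ b₁)
    (h2 : 0 ≤ b₂) (h1B : b₁ ≤ B) (h2B : b₂ ≤ B) (hB : 1 ≤ B) :
    |gaussOscSq l b₁ - gaussOscSq l b₂| ≤ 18 * l * B * |b₁ - b₂| := by
  have := abs_gaussOsc_sub_le (c := 2) (l := 2 * l) (by norm_num) (by linarith) h1 h2 h1B h2B hB
  rw [gaussOscSq_eq, gaussOscSq_eq, ← sub_div, add_sub_add_left_eq_sub, abs_div,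
    abs_of_pos (two_pos : (0 : ℝ) < 2)]
  linarith

/-- The quotient `gaussOsc / gaussOscSq`. -/
noncomputable def oscRatio (l b : ℝ) : ℝ := gaussOsc 1 l b / gaussOscSq l b

lemma abs_oscRatio_le {l b : ℝ} (hl : 1000 ≤ l) (hb : 1 ≤ b) :
    |oscRatio l b| ≤ 16 / √(l * b) := by
  have h1 := abs_gaussOsc_le (c := 1) (l := l) (b := b) one_pos (by linarith) (by linarith)
  have h2 := half_le_gaussOscSq hl hb
  rw [oscRatio, abs_div, abs_of_pos (by linarith : 0 < gaussOscSq l b),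
    div_le_iff₀ (by linarith)]
  have : 0 ≤ 8 / √(l * b) := by positivity
  calc _ ≤ 8 / √(l * b) := h1
    _ = 16 / √(l * b) * (1 / 2) := by ring
    _ ≤ _ := by gcongr

lemma abs_oscRatio_le_one {l b : ℝ} (hl : 1000 ≤ l) (hb : 1 ≤ b) : |oscRatio l b| ≤ 1 := by
  refine (abs_oscRatio_le hl hb).trans ?_
  have h2 : 16 ≤ √(l * b) := by
    apply Real.le_sqrt_of_sq_le
    nlinarith
  rw [div_le_one (by linarith)]
  exact h2

lemma abs_oscRatio_sub_le {l b₁ b₂ B : ℝ} (hl : 1000 ≤ l) (h1 : 1 ≤ b₁)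
    (h2 : 1 ≤ b₂) (h1B : b₁ ≤ B) (h2B : b₂ ≤ B) :
    |oscRatio l b₁ - oscRatio l b₂| ≤ 72 * l * B * |b₁ - b₂| := by
  have g := abs_gaussOsc_sub_le (c := 1) (l := l) le_rfl (by linarith) (by linarith)
    (by linarith) h1B h2B (h1.trans h1B)
  have d := abs_gaussOscSq_sub_le (l := l) (by linarith) (by linarith)
    (by linarith) h1B h2B (h1.trans h1B)
  have p1 := half_le_gaussOscSq hl h1
  have p2 := half_le_gaussOscSq hl h2
  have r2 := abs_oscRatio_le_one hl h2
  have e : oscRatio l b₁ - oscRatio l b₂ = ((gaussOsc 1 l b₁ - gaussOsc 1 l b₂) -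
      oscRatio l b₂ * (gaussOscSq l b₁ - gaussOscSq l b₂)) / gaussOscSq l b₁ := by
    have n1 : gaussOscSq l b₁ ≠ 0 := by linarith
    have n2 : gaussOscSq l b₂ ≠ 0 := by linarith
    rw [oscRatio, oscRatio]
    field_simp
    ring
  set Z := 18 * l * B * |b₁ - b₂|
  have k : |(gaussOsc 1 l b₁ - gaussOsc 1 l b₂) -
      oscRatio l b₂ * (gaussOscSq l b₁ - gaussOscSq l b₂)| ≤ 2 * Z := by
    refine (abs_sub _ _).trans ?_
    rw [abs_mul]
    have := mul_le_mul r2 d (abs_nonneg _) zero_le_one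
    linarith
  rw [e, abs_div, abs_of_pos (by linarith : 0 < gaussOscSq l b₁), div_le_iff₀ (by linarith)]
  have hZ : 0 ≤ Z := (abs_nonneg _).trans g
  have : 72 * l * B * |b₁ - b₂| = 4 * Z := by simp only [Z]; ring
  rw [this]
  nlinarith

end WeightedRay

/-! ### Size and Hölder regularity of the weight perturbation -/

namespace WeightedRay

/-- The perturbation of the constant weight, as a function of `u = 1 - |x|²` and
`a = u + (x · θ)²`. -/
noncomputable def profile (l u a : ℝ) : ℝ :=
  if 0 < u then oscRatio l a⁻¹ * Real.exp (a⁻¹ - u⁻¹) * Real.cos (l * u⁻¹ ^ 2) else 0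

lemma profile_of_nonpos {l u : ℝ} (hu : u ≤ 0) (a : ℝ) : profile l u a = 0 :=
  if_neg hu.not_gt

/-- Stationary phase only gives decay in `a`. The factor `exp(1/a - 1/u)` converts it into decay in
`u`, since `a/u = 1 + a (1/u - 1/a) ≤ exp(2 (1/u - 1/a))`. Hence the perturbation vanishes at the
boundary of the ball, uniformly in `a`. -/
lemma abs_profile_le {l u a : ℝ} (hl : 1000 ≤ l) (hu : 0 < u) (hua : u ≤ a) (ha : a ≤ 1) :
    |profile l u a| ≤ 16 * √(u / l) := by
  have ha0 : 0 < a := hu.trans_le hua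
  have hb : 1 ≤ a⁻¹ := (one_le_inv₀ ha0).2 ha
  have hby : a⁻¹ ≤ u⁻¹ := inv_anti₀ hu hua
  rw [profile, if_pos hu, abs_mul, abs_mul, abs_of_pos (Real.exp_pos _)]
  have h1 := abs_oscRatio_le hl hb
  have hk : Real.exp (a⁻¹ - u⁻¹) * (1 / √(l * a⁻¹)) ≤ √(u / l) := by
    rw [mul_one_div, div_le_iff₀ (Real.sqrt_pos.2 (by positivity)),
      ← Real.sqrt_mul (by positivity)]
    apply Real.le_sqrt_of_sq_le
    have e1 : u / l * (l * a⁻¹) = u / a := by field_simp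
    have e2 : Real.exp (a⁻¹ - u⁻¹) ^ 2 = (Real.exp (2 * (u⁻¹ - a⁻¹)))⁻¹ := by
      rw [← Real.exp_neg, ← Real.exp_nat_mul]; congr 1; push_cast; ring
    have e3 : u / a = (a / u)⁻¹ := by rw [inv_div]
    rw [e1, e2, e3]
    apply inv_anti₀ (by positivity)
    have e4 : a / u = 1 + a * (u⁻¹ - a⁻¹) := by field_simp; ring
    have e5 := Real.add_one_le_exp (2 * (u⁻¹ - a⁻¹))
    rw [e4]
    nlinarith
  calc _ ≤ 16 / √(l * a⁻¹) * Real.exp (a⁻¹ - u⁻¹) * 1 := by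
        gcongr
        exact Real.abs_cos_le_one _
    _ = 16 * (Real.exp (a⁻¹ - u⁻¹) * (1 / √(l * a⁻¹))) := by ring
    _ ≤ _ := by gcongr

lemma abs_inv_sub_inv_le {u x y : ℝ} (hu : 0 < u) (hx : u / 2 ≤ x) (hy : u ≤ y) :
    |x⁻¹ - y⁻¹| ≤ 2 / u ^ 2 * |x - y| := by
  have hx0 : 0 < x := by linarith
  have hy0 : 0 < y := by linarith
  have e : x⁻¹ - y⁻¹ = (y - x) / (x * y) := by field_simp
  rw [e, abs_div, abs_of_pos (mul_pos hx0 hy0), abs_sub_comm, div_le_iff₀ (by positivity)]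
  have : u ^ 2 / 2 ≤ x * y := by nlinarith
  calc |x - y| = 2 / u ^ 2 * |x - y| * (u ^ 2 / 2) := by field_simp
    _ ≤ _ := by gcongr

lemma abs_exp_sub_exp_le {x y : ℝ} (hx : x ≤ 0) (hy : y ≤ 0) :
    |Real.exp x - Real.exp y| ≤ |x - y| := by
  wlog h : x ≤ y generalizing x y
  · rw [abs_sub_comm, abs_sub_comm x]
    exact this hy hx (le_of_not_ge h)
  rw [abs_sub_comm, abs_sub_comm x, abs_of_nonneg (sub_nonneg.2 (Real.exp_le_exp.2 h)),
    abs_of_nonneg (sub_nonneg.2 h)]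
  have h1 : Real.exp x = Real.exp y * Real.exp (x - y) := by rw [← Real.exp_add]; ring_nf
  have h2 := Real.add_one_le_exp (x - y)
  have h3 : Real.exp y ≤ 1 := Real.exp_le_one_iff.2 hy
  have h4 := Real.exp_pos y
  rw [h1]
  nlinarith

lemma abs_profile_sub_le {l u₁ u₂ a₁ a₂ : ℝ} (hl : 1000 ≤ l) (hu : 0 < u₁) (hu1 : u₁ / 2 ≤ u₂)
    (h1 : u₁ ≤ a₁) (h2 : u₂ ≤ a₂) (h1' : a₁ ≤ 1) (h2' : a₂ ≤ 1) :
    |profile l u₁ a₁ - profile l u₂ a₂| ≤ 600 * (l / u₁ ^ 3) * (|u₁ - u₂| + |a₁ - a₂|) := by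
  have hu20 : 0 < u₂ := by linarith
  have ha1 : 0 < a₁ := by linarith
  have ha2 : 0 < a₂ := by linarith
  have hb1 : 1 ≤ a₁⁻¹ := (one_le_inv₀ ha1).2 h1'
  have hb2 : 1 ≤ a₂⁻¹ := (one_le_inv₀ ha2).2 h2'
  have hu11 : u₁ ≤ 1 := h1.trans h1'
  have hB1 : a₁⁻¹ ≤ 2 / u₁ := by
    rw [inv_eq_one_div, div_le_div_iff₀ ha1 hu]; linarith
  have hB2 : a₂⁻¹ ≤ 2 / u₁ := by
    rw [inv_eq_one_div, div_le_div_iff₀ ha2 hu]; linarith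
  have hY1 : u₁⁻¹ ≤ 2 / u₁ := by
    rw [inv_eq_one_div, div_le_div_iff₀ hu hu]; linarith
  have hY2 : u₂⁻¹ ≤ 2 / u₁ := by
    rw [inv_eq_one_div, div_le_div_iff₀ hu20 hu]; linarith
  have hda : |a₁⁻¹ - a₂⁻¹| ≤ 2 / u₁ ^ 2 * |a₁ - a₂| := by
    rw [abs_sub_comm, abs_sub_comm a₁]
    exact abs_inv_sub_inv_le hu (by linarith) h1
  have hdu : |u₁⁻¹ - u₂⁻¹| ≤ 2 / u₁ ^ 2 * |u₁ - u₂| := by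
    rw [abs_sub_comm, abs_sub_comm u₁]
    exact abs_inv_sub_inv_le hu hu1 le_rfl
  have hH := abs_oscRatio_sub_le hl hb1 hb2 hB1 hB2
  have hE : |Real.exp (a₁⁻¹ - u₁⁻¹) - Real.exp (a₂⁻¹ - u₂⁻¹)| ≤
      |a₁⁻¹ - a₂⁻¹| + |u₁⁻¹ - u₂⁻¹| := by
    refine (abs_exp_sub_exp_le (sub_nonpos.2 (inv_anti₀ hu h1))
      (sub_nonpos.2 (inv_anti₀ hu20 h2))).trans ?_
    rw [sub_sub_sub_comm]
    exact abs_sub _ _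
  have hC : |Real.cos (l * u₁⁻¹ ^ 2) - Real.cos (l * u₂⁻¹ ^ 2)| ≤
      l * (4 / u₁) * |u₁⁻¹ - u₂⁻¹| := by
    refine (abs_cos_sub_cos_le _ _).trans ?_
    have : l * u₁⁻¹ ^ 2 - l * u₂⁻¹ ^ 2 = l * (u₁⁻¹ + u₂⁻¹) * (u₁⁻¹ - u₂⁻¹) := by ring
    have hl0 : 0 ≤ l := by linarith
    rw [this, abs_mul, abs_of_nonneg (by positivity)]
    gcongr
    have : 4 / u₁ = 2 / u₁ + 2 / u₁ := by ring
    linarith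
  have hH2 := abs_oscRatio_le_one hl hb2
  have hE1 : |Real.exp (a₁⁻¹ - u₁⁻¹)| ≤ 1 := by
    rw [abs_of_pos (Real.exp_pos _)]
    exact Real.exp_le_one_iff.2 (sub_nonpos.2 (inv_anti₀ hu h1))
  have hE2 : |Real.exp (a₂⁻¹ - u₂⁻¹)| ≤ 1 := by
    rw [abs_of_pos (Real.exp_pos _)]
    exact Real.exp_le_one_iff.2 (sub_nonpos.2 (inv_anti₀ hu20 h2))
  have hC1 := Real.abs_cos_le_one (l * u₁⁻¹ ^ 2)
  rw [profile, profile, if_pos hu, if_pos hu20]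
  set H₁ := oscRatio l a₁⁻¹
  set H₂ := oscRatio l a₂⁻¹
  set E₁ := Real.exp (a₁⁻¹ - u₁⁻¹)
  set E₂ := Real.exp (a₂⁻¹ - u₂⁻¹)
  set C₁ := Real.cos (l * u₁⁻¹ ^ 2)
  set C₂ := Real.cos (l * u₂⁻¹ ^ 2)
  have e : H₁ * E₁ * C₁ - H₂ * E₂ * C₂ =
      (H₁ - H₂) * E₁ * C₁ + H₂ * (E₁ - E₂) * C₁ + H₂ * E₂ * (C₁ - C₂) := by ring
  have t1 : |(H₁ - H₂) * E₁ * C₁| ≤ |H₁ - H₂| := by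
    rw [abs_mul, abs_mul, mul_assoc]
    exact mul_le_of_le_one_right (abs_nonneg _) (mul_le_one₀ hE1 (abs_nonneg _) hC1)
  have t2 : |H₂ * (E₁ - E₂) * C₁| ≤ |E₁ - E₂| := by
    rw [abs_mul, abs_mul, mul_right_comm]
    exact mul_le_of_le_one_left (abs_nonneg _) (mul_le_one₀ hH2 (abs_nonneg _) hC1)
  have t3 : |H₂ * E₂ * (C₁ - C₂)| ≤ |C₁ - C₂| := by
    rw [abs_mul, abs_mul]
    exact mul_le_of_le_one_left (abs_nonneg _) (mul_le_one₀ hH2 (abs_nonneg _) hE2)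
  rw [e]
  have hl0 : 0 < l := by linarith
  have hw : 1 ≤ l * (1 / u₁) := by
    rw [mul_one_div, one_le_div hu]; linarith
  calc _ ≤ |H₁ - H₂| + |E₁ - E₂| + |C₁ - C₂| :=
        (abs_add_three _ _ _).trans (by gcongr)
    _ ≤ 72 * l * (2 / u₁) * |a₁⁻¹ - a₂⁻¹| + (l * (1 / u₁)) * (|a₁⁻¹ - a₂⁻¹| + |u₁⁻¹ - u₂⁻¹|) +
        l * (4 / u₁) * |u₁⁻¹ - u₂⁻¹| := by
        gcongr
        exact hE.trans (le_mul_of_one_le_left (by positivity) hw)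
    _ = (l / u₁) * (145 * |a₁⁻¹ - a₂⁻¹| + 5 * |u₁⁻¹ - u₂⁻¹|) := by ring
    _ ≤ (l / u₁) * (145 * (2 / u₁ ^ 2 * |a₁ - a₂|) + 5 * (2 / u₁ ^ 2 * |u₁ - u₂|)) := by gcongr
    _ = (l / u₁ ^ 3) * (290 * |a₁ - a₂| + 10 * |u₁ - u₂|) := by
        field_simp
        ring
    _ ≤ (l / u₁ ^ 3) * (600 * (|u₁ - u₂| + |a₁ - a₂|)) := by
        gcongr
        linarith [abs_nonneg (a₁ - a₂), abs_nonneg (u₁ - u₂)]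
    _ = _ := by ring

/-- If `u₂ ≤ u₁/2`, the increment `q` is at least `κ = u₁/l` and the size bound suffices. If `u₁`
and `u₂` are comparable, the size bound `κ^{1/2}` is interpolated with the Lipschitz bound `κ^{-3}
q`. -/
lemma abs_profile_sub_le_rpow_aux {α l u₁ u₂ a₁ a₂ : ℝ} (hα : 0 < α) (hα' : α < 1 / 16)
    (hl : 1000 ≤ l) (hu2 : u₂ ≤ u₁) (h1 : u₁ ≤ a₁) (h2 : u₂ ≤ a₂) (h1' : a₁ ≤ 1) (h2' : a₂ ≤ 1) :
    |profile l u₁ a₁ - profile l u₂ a₂| ≤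
      600 * l ^ (-(1 / 4) : ℝ) * (|u₁ - u₂| + |a₁ - a₂|) ^ α := by
  have hl0 : 0 < l := by linarith
  set q := |u₁ - u₂| + |a₁ - a₂|
  have hq : 0 ≤ q := by positivity
  rcases le_or_gt u₁ 0 with hu | hu
  · rw [profile_of_nonpos hu, profile_of_nonpos (hu2.trans hu), sub_self, abs_zero]
    positivity
  have hu1 : u₁ ≤ 1 := h1.trans h1'
  set κ := u₁ / l
  have hκ : 0 < κ := by positivity
  have hκl : κ ≤ l⁻¹ := by
    simp only [κ]
    rw [div_eq_mul_inv]
    exact mul_le_of_le_one_left (by positivity) hu1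
  have hκ1 : κ ≤ 1 := hκl.trans (inv_le_one_of_one_le₀ (by linarith))
  have hκq : κ ^ (1 / 4 : ℝ) ≤ l ^ (-(1 / 4) : ℝ) := by
    rw [Real.rpow_neg hl0.le, ← Real.inv_rpow hl0.le]
    gcongr
  have hp1 := abs_profile_le hl hu h1 h1'
  have hp2 : |profile l u₂ a₂| ≤ 16 * √κ := by
    rcases le_or_gt u₂ 0 with h | h
    · rw [profile_of_nonpos h, abs_zero]; positivity
    · refine (abs_profile_le hl h h2 h2').trans ?_
      simp only [κ]
      gcongr
  have hX : |profile l u₁ a₁ - profile l u₂ a₂| ≤ 32 * κ ^ (1 / 2 : ℝ) := by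
    rw [← Real.sqrt_eq_rpow]
    refine (abs_sub _ _).trans ?_
    linarith
  rcases le_or_gt u₂ (u₁ / 2) with h | h
  · have hqu : κ ≤ q := by
      have k1 : u₁ / 2 ≤ q := by
        have := le_abs_self (u₁ - u₂)
        have := abs_nonneg (a₁ - a₂)
        simp only [q]; linarith
      refine le_trans ?_ k1
      simp only [κ]
      gcongr
      linarith
    calc _ ≤ 32 * κ ^ (1 / 2 : ℝ) := hX
      _ ≤ 32 * κ ^ (1 / 4 + α : ℝ) := by
          gcongr 32 * ?_
          exact Real.rpow_le_rpow_of_exponent_ge hκ hκ1 (by linarith)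
      _ = 32 * κ ^ (1 / 4 : ℝ) * κ ^ α := by rw [Real.rpow_add hκ]; ring
      _ ≤ _ := by gcongr; norm_num
  · have hY := abs_profile_sub_le hl hu h.le h1 h2 h1' h2'
    have hκ3 : l / u₁ ^ 3 ≤ κ ^ (-3 : ℝ) := by
      have : κ ^ (-3 : ℝ) = l ^ 3 / u₁ ^ 3 := by
        rw [Real.rpow_neg hκ.le]
        norm_cast
        simp only [κ]
        rw [div_pow, inv_div]
      rw [this]
      gcongr
      nlinarith [mul_self_nonneg l, mul_self_nonneg (l - 1)]
    set T := |profile l u₁ a₁ - profile l u₂ a₂|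
    have hT : 0 ≤ T := abs_nonneg _
    calc T = T ^ (1 - α) * T ^ α := by
          rcases hT.eq_or_lt with h0 | h0
          · rw [← h0, Real.zero_rpow hα.ne', mul_zero]
          · rw [← Real.rpow_add h0]; simp
      _ ≤ (600 * κ ^ (1 / 2 : ℝ)) ^ (1 - α) * (600 * (κ ^ (-3 : ℝ) * q)) ^ α := by
          have : 0 ≤ 1 - α := by linarith
          gcongr
          · refine hX.trans ?_
            gcongr
            norm_num
          · rw [← mul_assoc]
            exact hY.trans (by gcongr)
      _ = 600 * (κ ^ (1 / 2 * (1 - α) + -3 * α) * q ^ α) := by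
          rw [Real.mul_rpow (by norm_num) (by positivity), Real.mul_rpow (by norm_num)
            (by positivity), Real.mul_rpow (by positivity) hq, ← Real.rpow_mul hκ.le,
            ← Real.rpow_mul hκ.le, Real.rpow_add hκ]
          have : (600 : ℝ) ^ (1 - α) * 600 ^ α = 600 := by
            rw [← Real.rpow_add (by norm_num)]; simp
          linear_combination (κ ^ (1 / 2 * (1 - α)) * κ ^ (-3 * α) * q ^ α) * this
      -- As `κ ≤ 1`, it suffices that `(1 - α)/2 - 3α ≥ 1/4`, that is `α ≤ 1/14`.
      _ ≤ 600 * (κ ^ (1 / 4 : ℝ) * q ^ α) := by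
          gcongr 600 * (?_ * _)
          exact Real.rpow_le_rpow_of_exponent_ge hκ hκ1 (by linarith)
      _ ≤ 600 * (l ^ (-(1 / 4) : ℝ) * q ^ α) := by gcongr
      _ = _ := by ring

lemma abs_profile_sub_le_rpow {α l u₁ u₂ a₁ a₂ : ℝ} (hα : 0 < α) (hα' : α < 1 / 16)
    (hl : 1000 ≤ l) (h1 : u₁ ≤ a₁) (h2 : u₂ ≤ a₂) (h1' : a₁ ≤ 1) (h2' : a₂ ≤ 1) :
    |profile l u₁ a₁ - profile l u₂ a₂| ≤
      600 * l ^ (-(1 / 4) : ℝ) * (|u₁ - u₂| + |a₁ - a₂|) ^ α := by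
  rcases le_total u₂ u₁ with h | h
  · exact abs_profile_sub_le_rpow_aux hα hα' hl h h1 h2 h1' h2'
  · rw [abs_sub_comm, abs_sub_comm u₁, abs_sub_comm a₁]
    exact abs_profile_sub_le_rpow_aux hα hα' hl h h2 h1 h2' h1'

lemma abs_profile_le_half {l u a : ℝ} (hl : 2000 ≤ l) (h : u ≤ a) (ha : a ≤ 1) :
    |profile l u a| ≤ 1 / 2 := by
  rcases le_or_gt u 0 with hu | hu
  · rw [profile_of_nonpos hu, abs_zero]; norm_num
  refine (abs_profile_le (by linarith) hu h ha).trans ?_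
  have : √(u / l) ≤ 1 / 32 := by
    rw [Real.sqrt_le_left (by norm_num), div_le_iff₀ (by linarith)]
    linarith
  linarith

end WeightedRay

/-! ### Smoothness of the oscillating bump function -/

namespace WeightedRay

open Polynomial Filter Topology

/-- The functions `(P(y) cos (l y²) + Q(y) sin (l y²)) √y exp (-y)` of `u = 1 / y > 0`, extended
by zero. -/
noncomputable def oscGlue (l : ℝ) (P Q : ℝ[X]) (u : ℝ) : ℝ :=
  (P.eval u⁻¹ * Real.cos (l * u⁻¹ ^ 2) + Q.eval u⁻¹ * Real.sin (l * u⁻¹ ^ 2)) * √u⁻¹ *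
    expNegInvGlue u

lemma oscGlue_of_nonpos (l : ℝ) (P Q : ℝ[X]) {u : ℝ} (hu : u ≤ 0) : oscGlue l P Q u = 0 := by
  rw [oscGlue, expNegInvGlue.zero_of_nonpos hu, mul_zero]

lemma tendsto_oscGlue_zero (l : ℝ) (P Q : ℝ[X]) : Tendsto (oscGlue l P Q) (𝓝 0) (𝓝 0) := by
  have hb : Tendsto (fun u : ℝ => |((1 + X) * P).eval u⁻¹ * expNegInvGlue u| +
      |((1 + X) * Q).eval u⁻¹ * expNegInvGlue u|) (𝓝 0) (𝓝 0) := by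
    have h := (expNegInvGlue.tendsto_polynomial_inv_mul_zero ((1 + X) * P)).abs.add
      (expNegInvGlue.tendsto_polynomial_inv_mul_zero ((1 + X) * Q)).abs
    rwa [abs_zero, add_zero] at h
  refine squeeze_zero_norm (fun u => ?_) hb
  rcases le_or_gt u 0 with hu | hu
  · rw [oscGlue_of_nonpos _ _ _ hu, norm_zero]; positivity
  have hy : 0 < u⁻¹ := inv_pos.2 hu
  have hs : √u⁻¹ ≤ 1 + u⁻¹ := by
    rw [Real.sqrt_le_left (by positivity)]
    nlinarith
  have hE := expNegInvGlue.nonneg u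
  simp only [oscGlue, Real.norm_eq_abs, abs_mul, abs_of_nonneg hE,
    abs_of_nonneg (Real.sqrt_nonneg _), eval_mul, eval_add, eval_one, eval_X,
    abs_of_nonneg (by positivity : 0 ≤ 1 + u⁻¹)]
  rw [← add_mul, ← mul_add, mul_comm (1 + u⁻¹)]
  gcongr
  refine (abs_add_le _ _).trans ?_
  rw [abs_mul, abs_mul]
  gcongr
  · exact mul_le_of_le_one_right (abs_nonneg _) (Real.abs_cos_le_one _)
  · exact mul_le_of_le_one_right (abs_nonneg _) (Real.abs_sin_le_one _)

/-- The family is closed under differentiation: `d/du = -y² d/dy` preserves the polynomial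
coefficients, and the derivative of `√y` yields `y² / (2√y) = √y · y/2`. Smoothness then follows by
induction on the order. -/
lemma hasDerivAt_oscGlue (l : ℝ) (P Q : ℝ[X]) (u : ℝ) :
    HasDerivAt (oscGlue l P Q)
      (oscGlue l (X ^ 2 * (P - derivative P - C (2 * l) * X * Q) - C (1 / 2) * X * P)
        (X ^ 2 * (Q - derivative Q + C (2 * l) * X * P) - C (1 / 2) * X * Q) u) u := by
  rcases lt_trichotomy u 0 with hu | rfl | hu
  · rw [oscGlue_of_nonpos _ _ _ hu.le]
    refine (hasDerivAt_const _ 0).congr_of_eventuallyEq ?_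
    filter_upwards [gt_mem_nhds hu] with y hy
    rw [oscGlue_of_nonpos _ _ _ hy.le]
  · rw [oscGlue_of_nonpos _ _ _ le_rfl, hasDerivAt_iff_tendsto_slope]
    -- The difference quotient at 0 is again a member of the family, with coefficients multiplied by
    -- `X`.
    refine ((tendsto_oscGlue_zero l (P * X) (Q * X)).mono_left inf_le_left).congr fun x => ?_
    simp only [slope_def_field, oscGlue, expNegInvGlue.zero, eval_mul, eval_X]
    ring
  · have hy : 0 < u⁻¹ := inv_pos.2 hu
    have d2 : HasDerivAt (fun y : ℝ => l * y ^ 2) (l * (2 * u⁻¹)) u⁻¹ := by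
      simpa using (hasDerivAt_pow 2 u⁻¹).const_mul l
    have dS := (hasDerivAt_id u⁻¹).sqrt hy.ne'
    have := (((((P.hasDerivAt u⁻¹).mul d2.cos).add ((Q.hasDerivAt u⁻¹).mul d2.sin)).mul
      dS).mul (hasDerivAt_neg u⁻¹).exp).comp u (hasDerivAt_inv hu.ne')
    convert! this.congr_of_eventuallyEq _ using 1
    · simp only [oscGlue, expNegInvGlue, hu.not_ge, if_false, eval_sub, eval_mul, eval_add,
        eval_pow, eval_X, eval_C, id_eq, Pi.mul_apply, Pi.add_apply]
      have hs : √u⁻¹ ^ 2 = u⁻¹ := Real.sq_sqrt hy.le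
      have hs0 : 0 < √u⁻¹ := Real.sqrt_pos.2 hy
      have e1 : 1 / (2 * √u⁻¹) = √u⁻¹ * u / 2 := by
        have : √u⁻¹ ^ 2 * u = 1 := by rw [hs]; field_simp
        rw [div_eq_iff (by positivity)]
        linear_combination -this
      have e2 : (u ^ 2)⁻¹ = u⁻¹ ^ 2 := by rw [inv_pow]
      have e3 : u = (u⁻¹)⁻¹ := by simp
      rw [e1, e2]
      have e4 : u⁻¹ * u = 1 := by field_simp
      generalize u⁻¹ = y at *
      linear_combination (P.eval y * Real.cos (l * y ^ 2) + Q.eval y * Real.sin (l * y ^ 2)) *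
        Real.exp (-y) * √y * y / 2 * e4
    · filter_upwards [lt_mem_nhds hu] with y hy
      simp [oscGlue, expNegInvGlue, hy.not_ge]

lemma contDiff_oscGlue (l : ℝ) (P Q : ℝ[X]) : ContDiff ℝ ∞ (oscGlue l P Q) := by
  apply contDiff_infty.2 fun m => ?_
  induction m generalizing P Q with
  | zero =>
    exact contDiff_zero.2 (continuous_iff_continuousAt.2 fun u =>
      (hasDerivAt_oscGlue l P Q u).continuousAt)
  | succ m ihm =>
    rw [show ((m + 1 : ℕ) : WithTop ℕ∞) = m + 1 from rfl]
    refine contDiff_succ_iff_deriv.2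
      ⟨fun u => (hasDerivAt_oscGlue l P Q u).differentiableAt, by simp, ?_⟩
    rw [funext fun u => (hasDerivAt_oscGlue l P Q u).deriv]
    exact ihm _ _

end WeightedRay

/-! ### Vanishing of the line integrals -/

namespace WeightedRay

open MeasureTheory Polynomial

section LineIntegral

/-- A parametrization of `(-√A, √A)` along which `(A - t²)⁻¹ = A⁻¹ + s²`. -/
noncomputable def chordParam (A s : ℝ) : ℝ := √A * (s / √(A⁻¹ + s ^ 2))

lemma hasDerivAt_chordParam {A : ℝ} (hA : 0 < A) (s : ℝ) :
    HasDerivAt (chordParam A) (√A * (A⁻¹ / ((A⁻¹ + s ^ 2) * √(A⁻¹ + s ^ 2)))) s := by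
  have hA' : 0 < A⁻¹ := inv_pos.2 hA
  have hy : 0 < A⁻¹ + s ^ 2 := by positivity
  have d2 : HasDerivAt (fun s : ℝ => A⁻¹ + s ^ 2) (2 * s) s := by
    simpa using (hasDerivAt_pow 2 s).const_add A⁻¹
  have hs : 0 < √(A⁻¹ + s ^ 2) := Real.sqrt_pos.2 hy
  have d := ((hasDerivAt_id s).div (d2.sqrt hy.ne') hs.ne').const_mul √A
  convert! d using 1
  have hsq : √(A⁻¹ + s ^ 2) ^ 2 = A⁻¹ + s ^ 2 := Real.sq_sqrt hy.le
  congr 1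
  set r := √(A⁻¹ + s ^ 2)
  have e : A⁻¹ = r ^ 2 - s ^ 2 := by rw [hsq]; ring
  rw [← hsq, e, id]
  field_simp

lemma sub_chordParam_sq {A : ℝ} (hA : 0 < A) (s : ℝ) :
    A - chordParam A s ^ 2 = (A⁻¹ + s ^ 2)⁻¹ := by
  have hA' : 0 < A⁻¹ := inv_pos.2 hA
  have hy : 0 < A⁻¹ + s ^ 2 := by positivity
  rw [chordParam, mul_pow, div_pow, Real.sq_sqrt hA.le, Real.sq_sqrt hy.le]
  have : A * A⁻¹ = 1 := mul_inv_cancel₀ hA.ne'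
  field_simp
  ring

lemma chordParam_injective {A : ℝ} (hA : 0 < A) : Function.Injective (chordParam A) := by
  refine (strictMono_of_deriv_pos fun s => ?_).injective
  rw [(hasDerivAt_chordParam hA s).deriv]
  have hA' : 0 < A⁻¹ := inv_pos.2 hA
  positivity

lemma mem_range_chordParam {A t : ℝ} (hA : 0 < A) (ht : 0 < A - t ^ 2) :
    t ∈ Set.range (chordParam A) := by
  refine ⟨t / (√A * √(A - t ^ 2)), ?_⟩
  have h1 : 0 < √A := Real.sqrt_pos.2 hA
  have h2 : 0 < √(A - t ^ 2) := Real.sqrt_pos.2 ht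
  have e : A⁻¹ + (t / (√A * √(A - t ^ 2))) ^ 2 = (1 / √(A - t ^ 2)) ^ 2 := by
    rw [div_pow, mul_pow, div_pow, Real.sq_sqrt hA.le, Real.sq_sqrt ht.le]
    field_simp
    ring
  rw [chordParam, e, Real.sqrt_sq (by positivity)]
  field_simp

lemma integral_profile_oscGlue_eq_zero {l A : ℝ} (hl : 1000 ≤ l) (hA1 : A ≤ 1) :
    ∫ t : ℝ, (1 - profile l (A - t ^ 2) A) * oscGlue l X 0 (A - t ^ 2) = 0 := by
  rcases le_or_gt A 0 with hA | hA
  · have : ∀ t : ℝ, oscGlue l X 0 (A - t ^ 2) = 0 := fun t =>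
      oscGlue_of_nonpos _ _ _ (by nlinarith [sq_nonneg t])
    simp [this]
  have hb0 : 0 < A⁻¹ := inv_pos.2 hA
  set b := A⁻¹ with hb
  have hb1 : 1 ≤ b := (one_le_inv₀ hA).2 hA1
  have hsupp : Function.support (fun t : ℝ =>
      (1 - profile l (A - t ^ 2) A) * oscGlue l X 0 (A - t ^ 2)) ⊆ chordParam A '' Set.univ := by
    intro t ht
    rw [Set.image_univ]
    apply mem_range_chordParam hA
    by_contra h
    exact ht (by simp [oscGlue_of_nonpos _ _ _ (not_lt.1 h)])
  rw [← setIntegral_eq_integral_of_forall_compl_eq_zero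
      (fun t ht => by_contra fun h => ht (hsupp h)),
    integral_image_eq_integral_abs_deriv_smul MeasurableSet.univ
      (fun s _ => (hasDerivAt_chordParam hA s).hasDerivWithinAt) (chordParam_injective hA).injOn,
    setIntegral_univ]
  -- The factor `y √y` of `oscGlue l X 0` is there to cancel the Jacobian. What remains is the
  -- integrand of `gaussOsc` minus `oscRatio` times that of `gaussOscSq`.
  have hpt : ∀ s : ℝ, |√A * (A⁻¹ / ((A⁻¹ + s ^ 2) * √(A⁻¹ + s ^ 2)))| •
      ((1 - profile l (A - chordParam A s ^ 2) A) * oscGlue l X 0 (A - chordParam A s ^ 2)) =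
      √A * b * Real.exp (-b) * (Real.exp (-1 * s ^ 2) * Real.cos (l * (b + s ^ 2) ^ 2) -
        oscRatio l b * (Real.exp (-2 * s ^ 2) * Real.cos (l * (b + s ^ 2) ^ 2) ^ 2)) := by
    intro s
    have hy : 0 < b + s ^ 2 := by positivity
    rw [sub_chordParam_sq hA, ← hb, smul_eq_mul, abs_of_nonneg (by positivity), profile,
      if_pos (inv_pos.2 hy), oscGlue, inv_inv, ← hb]
    simp only [expNegInvGlue, (inv_pos.2 hy).not_ge, if_false, inv_inv, eval_X, eval_zero]
    have e1 : Real.exp (b - (b + s ^ 2)) = Real.exp (-1 * s ^ 2) := by ring_nf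
    have e2 : Real.exp (-(b + s ^ 2)) = Real.exp (-b) * Real.exp (-1 * s ^ 2) := by
      rw [← Real.exp_add]; ring_nf
    have e3 : Real.exp (-2 * s ^ 2) = Real.exp (-1 * s ^ 2) * Real.exp (-1 * s ^ 2) := by
      rw [← Real.exp_add]; ring_nf
    have hr : 0 < √(b + s ^ 2) := Real.sqrt_pos.2 hy
    rw [e1, e2, e3]
    field_simp
    ring
  simp_rw [hpt]
  have hG := integrable_gaussOsc one_pos l b
  have hD : Integrable (fun s : ℝ => Real.exp (-2 * s ^ 2) * Real.cos (l * (b + s ^ 2) ^ 2) ^ 2) := by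
    refine (integrable_exp_neg_mul_sq two_pos).mono' (by fun_prop) (.of_forall fun s => ?_)
    rw [Real.norm_eq_abs, abs_mul, abs_of_pos (Real.exp_pos _), abs_of_nonneg (sq_nonneg _)]
    exact mul_le_of_le_one_right (Real.exp_pos _).le (Real.cos_sq_le_one _)
  rw [integral_const_mul, integral_sub hG (hD.const_mul _), integral_const_mul]
  change _ * (gaussOsc 1 l b - oscRatio l b * gaussOscSq l b) = 0
  have := half_le_gaussOscSq hl hb1
  rw [oscRatio, div_mul_cancel₀ _ (by linarith), sub_self, mul_zero]

end LineIntegral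

/-! ### Transfer to phase space and rescaling -/

section PhaseSpace

variable {d : ℕ}

lemma dist_fst_le (p q : PhaseSpace d) : ‖p.fst - q.fst‖ ≤ dist p q := by
  have h := (WithLp.prod_lipschitzWith_ofLp 2 (EuclideanSpace ℝ (Fin d))
    (Metric.sphere (0 : EuclideanSpace ℝ (Fin d)) 1)).dist_le_mul p q
  rw [NNReal.coe_one, one_mul, Prod.dist_eq] at h
  rw [← dist_eq_norm]
  exact (le_max_left _ _).trans h

lemma dist_snd_le (p q : PhaseSpace d) :
    ‖(p.snd : EuclideanSpace ℝ (Fin d)) - q.snd‖ ≤ dist p q := by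
  have h := (WithLp.prod_lipschitzWith_ofLp 2 (EuclideanSpace ℝ (Fin d))
    (Metric.sphere (0 : EuclideanSpace ℝ (Fin d)) 1)).dist_le_mul p q
  rw [NNReal.coe_one, one_mul, Prod.dist_eq] at h
  rw [← dist_eq_norm]
  exact (le_max_right _ _).trans h

lemma one_sub_norm_sq_add_inner_sq_le {E : Type*} [NormedAddCommGroup E] [InnerProductSpace ℝ E]
    (x : E) {θ : E} (hθ : ‖θ‖ = 1) : 1 - ‖x‖ ^ 2 + inner ℝ x θ ^ 2 ≤ 1 := by
  have h := abs_real_inner_le_norm x θ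
  rw [hθ, mul_one] at h
  have := sq_le_sq' (abs_le.1 h).1 (abs_le.1 h).2
  linarith

lemma abs_profile_phase_sub_le {E : Type*} [NormedAddCommGroup E] [InnerProductSpace ℝ E]
    {α l : ℝ} (hα : 0 < α) (hα' : α < 1 / 16) (hl : 1000 ≤ l) (x₁ x₂ : E) {θ₁ θ₂ : E}
    (h1 : ‖θ₁‖ = 1) (h2 : ‖θ₂‖ = 1) :
    |profile l (1 - ‖x₁‖ ^ 2) (1 - ‖x₁‖ ^ 2 + inner ℝ x₁ θ₁ ^ 2) -
      profile l (1 - ‖x₂‖ ^ 2) (1 - ‖x₂‖ ^ 2 + inner ℝ x₂ θ₂ ^ 2)| ≤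
      600 * l ^ (-(1 / 4) : ℝ) * (6 * (‖x₁ - x₂‖ + ‖θ₁ - θ₂‖)) ^ α := by
  wlog h12 : ‖x₁‖ ≤ ‖x₂‖ generalizing x₁ x₂ θ₁ θ₂
  · rw [abs_sub_comm, norm_sub_rev x₁, norm_sub_rev θ₁]
    exact this x₂ x₁ h2 h1 (le_of_not_ge h12)
  have hl0 : 0 < l := by linarith
  have ha1 := one_sub_norm_sq_add_inner_sq_le x₁ h1
  have ha2 := one_sub_norm_sq_add_inner_sq_le x₂ h2
  have hn := norm_sub_norm_le x₂ x₁
  rw [norm_sub_rev] at hn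
  have hx0 := norm_nonneg x₁
  have hθ0 := norm_nonneg (θ₁ - θ₂)
  rcases le_or_gt 1 ‖x₁‖ with hx1 | hx1
  · rw [profile_of_nonpos (by nlinarith), profile_of_nonpos (by nlinarith), sub_self, abs_zero]
    positivity
  rcases le_or_gt 1 ‖x₂‖ with hx2 | hx2
  -- Outside the ball `x₂` is unbounded and so is `(x₂·θ₂)²`. Since the profile vanishes for `u ≤ 0`
  -- whatever `a` is, the second point may be replaced by `(0, a₁)`.
  · rw [profile_of_nonpos (u := 1 - ‖x₂‖ ^ 2) (by nlinarith),
      ← profile_of_nonpos (l := l) (le_refl 0) (1 - ‖x₁‖ ^ 2 + inner ℝ x₁ θ₁ ^ 2)]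
    have hu : 0 ≤ 1 - ‖x₁‖ ^ 2 := by nlinarith
    refine (abs_profile_sub_le_rpow hα hα' hl (le_add_of_nonneg_right (sq_nonneg _))
      (by positivity) ha1 ha1).trans ?_
    rw [sub_self, abs_zero, add_zero, sub_zero, abs_of_nonneg hu]
    gcongr
    nlinarith
  · refine (abs_profile_sub_le_rpow hα hα' hl (le_add_of_nonneg_right (sq_nonneg _))
      (le_add_of_nonneg_right (sq_nonneg _)) ha1 ha2).trans ?_
    have k1 : |(1 - ‖x₁‖ ^ 2) - (1 - ‖x₂‖ ^ 2)| ≤ 2 * ‖x₁ - x₂‖ := by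
      rw [abs_of_nonneg (by nlinarith)]
      nlinarith
    have i1 := abs_real_inner_le_norm x₁ θ₁
    have i2 := abs_real_inner_le_norm x₂ θ₂
    have i3 : |inner ℝ x₁ θ₁ - inner ℝ x₂ θ₂| ≤ ‖x₁ - x₂‖ + ‖θ₁ - θ₂‖ := by
      have e : inner ℝ x₁ θ₁ - inner ℝ x₂ θ₂ =
          inner ℝ (x₁ - x₂) θ₁ + inner ℝ x₂ (θ₁ - θ₂) := by
        rw [inner_sub_left, inner_sub_right]; ring
      rw [e]
      have j1 := abs_real_inner_le_norm (x₁ - x₂) θ₁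
      have j2 := abs_real_inner_le_norm x₂ (θ₁ - θ₂)
      rw [h1, mul_one] at j1
      refine (abs_add_le _ _).trans (add_le_add j1 (j2.trans ?_))
      exact mul_le_of_le_one_left hθ0 hx2.le
    rw [h1, mul_one] at i1
    rw [h2, mul_one] at i2
    have k2 : |inner ℝ x₁ θ₁ ^ 2 - inner ℝ x₂ θ₂ ^ 2| ≤ 2 * (‖x₁ - x₂‖ + ‖θ₁ - θ₂‖) := by
      rw [sq_sub_sq, abs_mul]
      gcongr
      refine (abs_add_le _ _).trans ?_
      linarith
    have k3 : |(1 - ‖x₁‖ ^ 2 + inner ℝ x₁ θ₁ ^ 2) - (1 - ‖x₂‖ ^ 2 + inner ℝ x₂ θ₂ ^ 2)| ≤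
        |(1 - ‖x₁‖ ^ 2) - (1 - ‖x₂‖ ^ 2)| + |inner ℝ x₁ θ₁ ^ 2 - inner ℝ x₂ θ₂ ^ 2| := by
      rw [add_sub_add_comm]
      exact abs_add_le _ _
    gcongr
    linarith

/-- The weight, concentrated in the ball of radius `δ`. -/
noncomputable def oscWeight (l δ : ℝ) (p : PhaseSpace d) : ℝ :=
  1 - profile l (1 - ‖δ⁻¹ • p.fst‖ ^ 2)
    (1 - ‖δ⁻¹ • p.fst‖ ^ 2 + inner ℝ (δ⁻¹ • p.fst) (p.snd : EuclideanSpace ℝ (Fin d)) ^ 2)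

/-- The radial function in the kernel of the weighted ray transform. -/
noncomputable def oscFun (l δ : ℝ) (x : EuclideanSpace ℝ (Fin d)) : ℝ :=
  oscGlue l X 0 (1 - ‖δ⁻¹ • x‖ ^ 2)

lemma abs_one_sub_oscWeight_le {l : ℝ} (hl : 2000 ≤ l) (δ : ℝ) (p : PhaseSpace d) :
    |1 - oscWeight l δ p| ≤ 1 / 2 := by
  rw [oscWeight, sub_sub_cancel]
  exact abs_profile_le_half hl (le_add_of_nonneg_right (sq_nonneg _))
    (one_sub_norm_sq_add_inner_sq_le _ (norm_eq_of_mem_sphere p.snd))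

lemma abs_oscWeight_sub_le {α l δ : ℝ} (hα : 0 < α) (hα' : α < 1 / 16) (hl : 1000 ≤ l)
    (hδ : 0 < δ) (hδ1 : δ ≤ 1) (p q : PhaseSpace d) :
    |oscWeight l δ p - oscWeight l δ q| ≤
      7200 * δ⁻¹ * l ^ (-(1 / 4) : ℝ) * dist p q ^ α := by
  have hl0 : 0 < l := by linarith
  have hδi : 1 ≤ δ⁻¹ := (one_le_inv₀ hδ).2 hδ1
  rw [oscWeight, oscWeight, sub_sub_sub_cancel_left, abs_sub_comm]
  refine (abs_profile_phase_sub_le hα hα' hl _ _ (norm_eq_of_mem_sphere p.snd)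
    (norm_eq_of_mem_sphere q.snd)).trans ?_
  have h1 := dist_fst_le p q
  have h2 := dist_snd_le p q
  have hd : 0 ≤ dist p q := dist_nonneg
  have h3 : ‖δ⁻¹ • p.fst - δ⁻¹ • q.fst‖ ≤ δ⁻¹ * dist p q := by
    rw [← smul_sub, norm_smul, Real.norm_of_nonneg (by positivity)]
    gcongr
  calc _ ≤ 600 * l ^ (-(1 / 4) : ℝ) * (12 * δ⁻¹ * dist p q) ^ α := by
        have h4 : 1 * dist p q ≤ δ⁻¹ * dist p q := by gcongr
        gcongr 600 * _ * ?_ ^ α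
        linarith
    _ = 600 * l ^ (-(1 / 4) : ℝ) * ((12 * δ⁻¹) ^ α * dist p q ^ α) := by
        rw [Real.mul_rpow (by positivity) hd]
    _ ≤ 600 * l ^ (-(1 / 4) : ℝ) * ((12 * δ⁻¹) ^ (1 : ℝ) * dist p q ^ α) := by
        gcongr
        · linarith
        · linarith
    _ = _ := by rw [Real.rpow_one]; ring

lemma holderNorm_le {Y : Type*} [MetricSpace Y] {α M K : ℝ} {u : Y → ℝ} (hM : 0 ≤ M)
    (hK : 0 ≤ K) (hu : ∀ y, |u y| ≤ M) (hd : ∀ y z, |u y - u z| ≤ K * dist y z ^ α) :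
    holderNorm α u ≤ ENNReal.ofReal (M + K) := by
  rw [ENNReal.ofReal_add hM hK]
  refine add_le_add (iSup_le fun y => ?_) ?_
  · rw [Real.enorm_eq_ofReal_abs]
    exact ENNReal.ofReal_le_ofReal (hu y)
  · refine iSup_le fun y => iSup_le fun z => iSup_le fun hyz => iSup_le fun _ => ?_
    apply ENNReal.ofReal_le_ofReal
    rw [div_le_iff₀ (Real.rpow_pos_of_pos (dist_pos.2 hyz) _)]
    exact hd y z

lemma contDiff_oscFun (l δ : ℝ) : ContDiff ℝ ∞ (oscFun (d := d) l δ) :=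
  (contDiff_oscGlue l X 0).comp
    (contDiff_const.sub ((contDiff_norm_sq ℝ).comp (contDiff_const_smul δ⁻¹)))

lemma tsupport_oscFun_subset (l : ℝ) {δ : ℝ} (hδ : 0 < δ) :
    tsupport (oscFun (d := d) l δ) ⊆ Metric.closedBall 0 δ := by
  refine closure_minimal (fun x hx => ?_) Metric.isClosed_closedBall
  rw [mem_closedBall_zero_iff]
  by_contra! h
  refine hx (oscGlue_of_nonpos _ _ _ ?_)
  rw [norm_smul, Real.norm_of_nonneg (by positivity)]
  have : 1 ≤ δ⁻¹ * ‖x‖ := by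
    rw [inv_mul_eq_div, one_le_div hδ]
    exact h.le
  nlinarith

/-- Frequencies in `2πℕ` make `cos l = 1`, so the value at the origin is `exp(-1)`. -/
lemma oscFun_ne_zero (n : ℕ) (δ : ℝ) : oscFun (d := d) (n * (2 * Real.pi)) δ ≠ 0 := by
  intro h
  have := congrFun h 0
  simp only [oscFun, oscGlue, smul_zero, norm_zero, Pi.zero_apply] at this
  norm_num [expNegInvGlue, Real.cos_nat_mul_two_pi] at this

lemma rayTransform_oscWeight_oscFun {l : ℝ} (δ : ℝ) (hl : 1000 ≤ l) {p : PhaseSpace d}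
    (hp : p ∈ tangentSphere d) : rayTransform (oscWeight l δ) (oscFun l δ) p = 0 := by
  set x := p.fst with hx
  set θ : EuclideanSpace ℝ (Fin d) := p.snd.1 with hθ
  have hθ1 : ‖θ‖ = 1 := norm_eq_of_mem_sphere p.snd
  have hp0 : inner ℝ x θ = 0 := hp
  set A := 1 - ‖δ⁻¹ • x‖ ^ 2 with hA
  have hpt : ∀ t : ℝ, oscWeight l δ (PhaseSpace.mk (x + t • θ) p.snd) * oscFun l δ (x + t • θ) =
      (fun t : ℝ => (1 - profile l (A - t ^ 2) A) * oscGlue l X 0 (A - t ^ 2)) (t / δ) := by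
    intro t
    have e1 : 1 - ‖δ⁻¹ • (x + t • θ)‖ ^ 2 = A - (t / δ) ^ 2 := by
      have : ‖x + t • θ‖ ^ 2 = ‖x‖ ^ 2 + t ^ 2 := by
        rw [norm_add_sq_real, inner_smul_right, hp0, norm_smul, hθ1, mul_one, Real.norm_eq_abs,
          sq_abs]
        ring
      rw [hA, norm_smul, norm_smul, mul_pow, mul_pow, this, Real.norm_eq_abs, sq_abs]
      ring
    have e2 : inner ℝ (δ⁻¹ • (x + t • θ)) θ = t / δ := by
      rw [real_inner_smul_left, inner_add_left, real_inner_smul_left, hp0,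
        real_inner_self_eq_norm_sq, hθ1]
      ring
    have e3 : oscWeight l δ (PhaseSpace.mk (x + t • θ) p.snd) =
      1 - profile l (1 - ‖δ⁻¹ • (x + t • θ)‖ ^ 2)
        (1 - ‖δ⁻¹ • (x + t • θ)‖ ^ 2 + inner ℝ (δ⁻¹ • (x + t • θ)) θ ^ 2) := rfl
    rw [e3, oscFun, e1, e2, sub_add_cancel]
  rw [rayTransform]
  simp_rw [← hx, ← hθ, hpt]
  rw [Measure.integral_comp_div
      (fun t : ℝ => (1 - profile l (A - t ^ 2) A) * oscGlue l X 0 (A - t ^ 2)),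
    integral_profile_oscGlue_eq_zero hl (by rw [hA]; linarith [sq_nonneg ‖δ⁻¹ • x‖]), smul_zero]

end PhaseSpace

end WeightedRay

/-! ### Choice of the frequency -/

theorem corollary1 (α : ℝ) (hα : α ∈ Set.Ioo (0 : ℝ) (1 / 16)) :
    ∃ N : ℝ, 0 < N ∧ ∀ δ : ℝ, 0 < δ →
      ∃ (W : WeightedRay.PhaseSpace 2 → ℝ) (f : EuclideanSpace ℝ (Fin 2) → ℝ),
        (∀ p, 1 / 2 ≤ W p) ∧
        WeightedRay.MemHolderSpace α W ∧
        WeightedRay.holderNorm α W ≤ ENNReal.ofReal N ∧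
        ContDiff ℝ ∞ f ∧
        f ≠ 0 ∧
        tsupport f ⊆ Metric.closedBall (0 : EuclideanSpace ℝ (Fin 2)) δ ∧
        ∀ p ∈ WeightedRay.tangentSphere 2, WeightedRay.rayTransform W f p = 0 := by
  -- `3/2` bounds the supremum, because the weight is within `1/2` of 1; the summand 1 bounds the
  -- Hölder seminorm once `l^{1/4} ≥ 7200/r`.
  refine ⟨3 / 2 + 1, by norm_num, fun δ hδ => ?_⟩
  set r := min δ 1
  have hr : 0 < r := lt_min hδ one_pos
  have hr1 : r ≤ 1 := min_le_right _ _
  obtain ⟨n, hn⟩ := exists_nat_ge (2000 + (7200 * r⁻¹) ^ 4)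
  set l : ℝ := n * (2 * Real.pi)
  have hnl : (n : ℝ) ≤ l :=
    le_mul_of_one_le_right (Nat.cast_nonneg n) (by linarith [Real.pi_gt_three])
  have hri : 0 < 7200 * r⁻¹ := by positivity
  have hl : 2000 ≤ l := by linarith [pow_pos hri 4]
  have hl4 : (7200 * r⁻¹) ^ 4 ≤ l := by linarith
  have hK : 7200 * r⁻¹ * l ^ (-(1 / 4) : ℝ) ≤ 1 := by
    have h1 : 7200 * r⁻¹ ≤ l ^ (1 / 4 : ℝ) := by
      calc 7200 * r⁻¹ = ((7200 * r⁻¹) ^ 4) ^ (1 / 4 : ℝ) := by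
            rw [← Real.rpow_natCast, ← Real.rpow_mul hri.le]
            norm_num
        _ ≤ _ := by gcongr
    rw [Real.rpow_neg (by linarith), ← div_eq_mul_inv]
    exact div_le_one_of_le₀ h1 (Real.rpow_nonneg (by linarith) _)
  have hN : WeightedRay.holderNorm α (WeightedRay.oscWeight (d := 2) l r) ≤
      ENNReal.ofReal (3 / 2 + 1) := by
    refine WeightedRay.holderNorm_le (by norm_num) zero_le_one (fun p => ?_) fun p q => ?_
    · have := abs_le.1 (WeightedRay.abs_one_sub_oscWeight_le hl r p)
      rw [abs_le]
      constructor <;> linarith [this.1, this.2]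
    · refine (WeightedRay.abs_oscWeight_sub_le hα.1 hα.2 (by linarith) hr hr1 p q).trans ?_
      have : 0 ≤ dist p q ^ α := Real.rpow_nonneg dist_nonneg _
      gcongr
  refine ⟨WeightedRay.oscWeight l r, WeightedRay.oscFun l r, fun p => ?_,
    hN.trans_lt ENNReal.ofReal_lt_top, hN, WeightedRay.contDiff_oscFun l r,
    WeightedRay.oscFun_ne_zero n r,
    (WeightedRay.tsupport_oscFun_subset l hr).trans
      (Metric.closedBall_subset_closedBall (min_le_left _ _)),
    fun p hp => WeightedRay.rayTransform_oscWeight_oscFun r (by linarith) hp⟩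
  have := abs_le.1 (WeightedRay.abs_one_sub_oscWeight_le hl r p)
  linarith [this.2]
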